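/- All matrices are real. A proper cone in $\mathbb{R}^m$ is a closed set $K$ with $K+K\subseteq K$, $aK\subseteq K$ for all $a\ge 0$, $K\cap(-K)=\{0\}$ and nonempty interior. For an $m\times m$ matrix $A$ let $\rho(A)$ be its spectral radius, and let the degree of an eigenvalue be its multiplicity as a root of the minimal polynomial of $A$. Call $A$ a Vandergraft matrix if $\rho(A)$ is an eigenvalue of $A$ and its degree is at least the degree of every (complex) eigenvalue $\lambda$ of $A$ with $|\lambda|=\rho(A)$; a dominant eigenvector of $A$ is a nonzero $x\in\mathbb{R}^m$ with $Ax=\rho(A)x$. For a symmetric positive definite $m\times m$ matrix $V$ and $x\ne 0$, the $V$-weighted ice-cream cone around $x$ is $$\mathcal{K}_V(x)=\{cx+y:\ c\in\mathbb{R},\ y\in\mathbb{R}^m,\ x^TVy=0,\ (y^TVy)^{1/2}\le c\,(x^TVx)^{1/2}\}.$$ Theorem. Let $0\neq x\in\mathbb{R}^m$ and let $\mathcal{A}$ be a (possibly infinite) set of $m\times m$ Vandergraft matrices all of which have $x$ as a dominant eigenvector. Assume that at least one of the following holds: (1) there is a real invertible matrix $S$ such that $S^{-1}AS$ is normal for every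 $A\in\mathcal{A}$; (2) $\mathcal{A}$ is finite, the matrices in $\mathcal{A}$ commute pairwise, and for every $A\in\mathcal{A}$ the eigenvalue $\rho(A)$ is semisimple, i.e. a simple root of the minimal polynomial of $A$. Then there is a proper cone $K$ with $AK\subseteq K$ for all $A\in\mathcal{A}$ and with $x$ in the interior of $K$; moreover, $K$ can be chosen of the form $K=\mathcal{K}_V(x)$ for some symmetric positive definite matrix $V$. In case (1), for every $S$ as in (1), one such cone is the image $S\,\mathcal{K}_I(S^{-1}x)$ of the Euclidean ice-cream cone around $S^{-1}x$. -/

import Mathlib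

open Matrix

noncomputable section

namespace CommonCone

/-- A proper cone in `ℝ^m`: closed under multiplication by scalars `a ≥ 0` and under addition,
topologically closed, pointed (`K ∩ -K = {0}`) and solid (nonempty interior). -/
structure IsProperCone {m : ℕ} (K : Set (Fin m → ℝ)) : Prop where
  smul_mem : ∀ a : ℝ, 0 ≤ a → ∀ v ∈ K, a • v ∈ K
  add_mem : ∀ v ∈ K, ∀ w ∈ K, v + w ∈ K
  closed : IsClosed K
  pointed : {v | v ∈ K ∧ -v ∈ K} = {0}
  solid : (interior K).Nonempty

/-- `K` is invariant under `A`: `A v ∈ K` for every `v ∈ K`. -/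
def IsInvariant {m : ℕ} (A : Matrix (Fin m) (Fin m) ℝ) (K : Set (Fin m → ℝ)) : Prop :=
  ∀ v ∈ K, A *ᵥ v ∈ K

/-- A real matrix regarded as a complex one. -/
def toComplex {m : ℕ} (A : Matrix (Fin m) (Fin m) ℝ) : Matrix (Fin m) (Fin m) ℂ :=
  A.map (algebraMap ℝ ℂ)

/-- The spectral radius `ρ(A)`: the largest modulus of a complex eigenvalue of `A`. -/
def specRadius {m : ℕ} (A : Matrix (Fin m) (Fin m) ℝ) : ℝ :=
  (spectralRadius ℂ (toComplex A)).toReal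

/-- The degree of `μ`: its multiplicity as a root of the minimal polynomial of `A`. -/
def degree {m : ℕ} (A : Matrix (Fin m) (Fin m) ℝ) (μ : ℂ) : ℕ :=
  (minpoly ℂ (toComplex A)).rootMultiplicity μ

/-- Vandergraft matrices: `ρ(A)` is an eigenvalue, and its degree is at least that of every
eigenvalue on the circle `|μ| = ρ(A)`. -/
structure IsVandergraft {m : ℕ} (A : Matrix (Fin m) (Fin m) ℝ) : Prop where
  mem_spectrum : (specRadius A : ℂ) ∈ spectrum ℂ (toComplex A)
  degree_le : ∀ μ ∈ spectrum ℂ (toComplex A), ‖μ‖ = specRadius A →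
    degree A μ ≤ degree A (specRadius A : ℂ)

/-- `x` is a (real) eigenvector of `A` for the eigenvalue `ρ(A)`. -/
def IsDominantEigenvector {m : ℕ} (A : Matrix (Fin m) (Fin m) ℝ) (x : Fin m → ℝ) : Prop :=
  x ≠ 0 ∧ A *ᵥ x = specRadius A • x

/-- The real invertible matrix `S` transforms every member of `𝒜` into a normal matrix. -/
def NormalizedBy {m : ℕ} (𝒜 : Set (Matrix (Fin m) (Fin m) ℝ))
    (S : Matrix (Fin m) (Fin m) ℝ) : Prop :=
  IsUnit S ∧ ∀ A ∈ 𝒜, IsStarNormal (S⁻¹ * A * S)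

/-- Finite commuting family in which every `ρ(A)` is a simple root of the minimal polynomial. -/
def IsFiniteCommutingSemisimple {m : ℕ} (𝒜 : Set (Matrix (Fin m) (Fin m) ℝ)) : Prop :=
  𝒜.Finite ∧ (∀ A ∈ 𝒜, ∀ B ∈ 𝒜, A * B = B * A) ∧
    ∀ A ∈ 𝒜, degree A (specRadius A : ℂ) = 1

/-- The `V`-weighted ice-cream cone around `x`: all `c x + y` with `y` orthogonal to `x` and
`‖y‖ ≤ c ‖x‖`, where orthogonality and norm refer to the inner product `(v, w) ↦ vᵀ V w`.
For `V = 1` this is the Euclidean ice-cream cone around `x`. -/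
def iceCreamCone {m : ℕ} (V : Matrix (Fin m) (Fin m) ℝ) (x : Fin m → ℝ) : Set (Fin m → ℝ) :=
  {v | ∃ (c : ℝ) (y : Fin m → ℝ), v = c • x + y ∧ x ⬝ᵥ (V *ᵥ y) = 0 ∧
    √(y ⬝ᵥ (V *ᵥ y)) ≤ c * √(x ⬝ᵥ (V *ᵥ x))}

/-- `K` is a common invariant proper cone of the family `𝒜` with `x` in its interior. -/
structure IsCommonConeAround {m : ℕ} (𝒜 : Set (Matrix (Fin m) (Fin m) ℝ))
    (x : Fin m → ℝ) (K : Set (Fin m → ℝ)) : Prop where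
  proper : IsProperCone K
  invariant : ∀ A ∈ 𝒜, IsInvariant A K
  mem_interior : x ∈ interior K

end CommonCone

end

/-! Everything reduces to an inner product `V` in which each `A` has operator norm at most `ρ(A)`.
Since `x` attains that norm, it is also an eigenvector of the `V`-adjoint of `A`. Hence `A` scales
the `V`-component along `x` by exactly `ρ(A)` and `V`-lengths by at most `ρ(A)`, which preserves the
ice-cream cone (`isInvariant_iceCreamCone`).

In case (1), `V = S⁻ᵀS⁻¹` works because a normal matrix has Euclidean norm equal to its spectral
radius.

In case (2), the Vandergraft condition makes every eigenvalue on the spectral circle semisimple. A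
Hermitian form is built over `ℂ` by adding one matrix `B` at a time
(`exists_posDef_isBoundedBy_insert`). The old form is pulled back along polynomials in `B`; these
commute with the family, so earlier bounds survive. Peripheral eigenvalues give exact equality, and
the remaining ones are handled by rapidly growing weights (`exists_chain_form`). The real part of
the form is `V`. -/

noncomputable section

namespace CommonCone

/-! ### Ice-cream cones of a positive definite form -/

section Geometry

variable {m : ℕ} {V : Matrix (Fin m) (Fin m) ℝ}

theorem dotProduct_mulVec_comm (hV : V.PosDef) (v w : Fin m → ℝ) :
    v ⬝ᵥ (V *ᵥ w) = w ⬝ᵥ (V *ᵥ v) := by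
  have h : Vᵀ = V := by simpa using hV.isHermitian.eq
  rw [dotProduct_mulVec, ← mulVec_transpose, h, dotProduct_comm]

theorem dotProduct_mulVec_self_nonneg (hV : V.PosDef) (v : Fin m → ℝ) :
    0 ≤ v ⬝ᵥ (V *ᵥ v) := by
  simpa using hV.posSemidef.dotProduct_mulVec_nonneg v

theorem dotProduct_mulVec_self_pos (hV : V.PosDef) {v : Fin m → ℝ} (hv : v ≠ 0) :
    0 < v ⬝ᵥ (V *ᵥ v) := by
  simpa using hV.dotProduct_mulVec_pos hv

theorem form_add_smul (hV : V.PosDef) (v w : Fin m → ℝ) (a b : ℝ) :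
    (a • v + b • w) ⬝ᵥ (V *ᵥ (a • v + b • w)) =
      a ^ 2 * (v ⬝ᵥ (V *ᵥ v)) + 2 * a * b * (v ⬝ᵥ (V *ᵥ w)) + b ^ 2 * (w ⬝ᵥ (V *ᵥ w)) := by
  simp only [mulVec_add, mulVec_smul, dotProduct_add, add_dotProduct, smul_dotProduct,
    dotProduct_smul, smul_eq_mul, dotProduct_mulVec_comm hV w v]
  ring

theorem form_cauchy_schwarz (hV : V.PosDef) (v w : Fin m → ℝ) :
    v ⬝ᵥ (V *ᵥ w) ≤ √(v ⬝ᵥ (V *ᵥ v)) * √(w ⬝ᵥ (V *ᵥ w)) := by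
  rw [← Real.sqrt_mul (dotProduct_mulVec_self_nonneg hV v)]
  apply Real.le_sqrt_of_sq_le
  by_cases hw : w = 0
  · simp [hw]
  have hp := dotProduct_mulVec_self_pos hV hw
  have h := dotProduct_mulVec_self_nonneg hV
    ((w ⬝ᵥ (V *ᵥ w)) • v + (-(v ⬝ᵥ (V *ᵥ w))) • w)
  rw [form_add_smul hV] at h
  have h2 : 0 ≤ (w ⬝ᵥ (V *ᵥ w)) * ((v ⬝ᵥ (V *ᵥ v)) * (w ⬝ᵥ (V *ᵥ w)) - (v ⬝ᵥ (V *ᵥ w)) ^ 2) := by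
    linarith
  have := nonneg_of_mul_nonneg_right h2 hp
  linarith

theorem sqrt_form_add_le (hV : V.PosDef) (v w : Fin m → ℝ) :
    √((v + w) ⬝ᵥ (V *ᵥ (v + w))) ≤ √(v ⬝ᵥ (V *ᵥ v)) + √(w ⬝ᵥ (V *ᵥ w)) := by
  apply Real.sqrt_le_iff.2 ⟨by positivity, ?_⟩
  have h := form_add_smul hV v w 1 1
  simp only [one_smul] at h
  rw [h, add_sq, Real.sq_sqrt (dotProduct_mulVec_self_nonneg hV v),
    Real.sq_sqrt (dotProduct_mulVec_self_nonneg hV w)]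
  linarith [form_cauchy_schwarz hV v w]

theorem sqrt_form_smul (hV : V.PosDef) (v : Fin m → ℝ) {a : ℝ} (ha : 0 ≤ a) :
    √((a • v) ⬝ᵥ (V *ᵥ (a • v))) = a * √(v ⬝ᵥ (V *ᵥ v)) := by
  have h := form_add_smul hV v 0 a 0
  simp only [smul_zero, add_zero] at h
  rw [h, mul_zero, zero_mul, zero_pow two_ne_zero, zero_mul, add_zero, add_zero,
    Real.sqrt_mul (sq_nonneg a), Real.sqrt_sq ha]

/-- The ice-cream cone is cut out by a half-aperture of 45 degrees. -/
theorem mem_iceCreamCone_iff (hV : V.PosDef) {x : Fin m → ℝ} (hx : x ≠ 0) (v : Fin m → ℝ) :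
    v ∈ iceCreamCone V x ↔
      √(v ⬝ᵥ (V *ᵥ v)) * √(x ⬝ᵥ (V *ᵥ x)) ≤ √2 * (x ⬝ᵥ (V *ᵥ v)) := by
  have hp := dotProduct_mulVec_self_pos hV hx
  set X := x ⬝ᵥ (V *ᵥ x) with hX
  have hsX : 0 < √X := Real.sqrt_pos.2 hp
  have h2 : 0 < √(2 : ℝ) := by positivity
  have key : ∀ (c : ℝ) (y : Fin m → ℝ), x ⬝ᵥ (V *ᵥ y) = 0 →
      x ⬝ᵥ (V *ᵥ (c • x + y)) = c * X ∧
      (c • x + y) ⬝ᵥ (V *ᵥ (c • x + y)) = c ^ 2 * X + y ⬝ᵥ (V *ᵥ y) := by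
    intro c y hy
    have h := form_add_smul hV x y c 1
    simp only [one_smul, hy] at h
    refine ⟨by simp [mulVec_add, mulVec_smul, hy, hX], by rw [h]; ring⟩
  -- By Pythagoras, adding `c²X` to both sides of `‖y‖² ≤ c²X` gives `‖c x + y‖² ≤ 2c²X`, whence the
  -- `√2`.
  have equiv : ∀ (c : ℝ) (y : Fin m → ℝ), x ⬝ᵥ (V *ᵥ y) = 0 →
      (√(y ⬝ᵥ (V *ᵥ y)) ≤ c * √X ↔
        √((c • x + y) ⬝ᵥ (V *ᵥ (c • x + y))) * √X ≤ √2 * (x ⬝ᵥ (V *ᵥ (c • x + y)))) := by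
    intro c y hy
    obtain ⟨h1, h3⟩ := key c y hy
    rw [h1, h3]
    have hY := dotProduct_mulVec_self_nonneg hV y
    have e : √2 * (c * X) = (√2 * (c * √X)) * √X := by
      rw [mul_assoc, mul_assoc, Real.mul_self_sqrt hp.le]
    rw [e, mul_le_mul_iff_left₀ hsX, Real.sqrt_le_iff, Real.sqrt_le_iff]
    have s1 : (c * √X) ^ 2 = c ^ 2 * X := by rw [mul_pow, Real.sq_sqrt hp.le]
    have s2 : (√2 * (c * √X)) ^ 2 = 2 * (c ^ 2 * X) := by
      rw [mul_pow, s1, Real.sq_sqrt (by norm_num)]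
    rw [s1, s2, mul_nonneg_iff_of_pos_left h2]
    constructor
    · rintro ⟨a, b⟩; exact ⟨a, by linarith⟩
    · rintro ⟨a, b⟩; exact ⟨a, by linarith⟩
  constructor
  · rintro ⟨c, y, rfl, hy, hle⟩
    exact (equiv c y hy).1 hle
  · intro h
    have hy : x ⬝ᵥ (V *ᵥ (v - ((x ⬝ᵥ (V *ᵥ v)) / X) • x)) = 0 := by
      simp only [mulVec_sub, mulVec_smul, dotProduct_sub, dotProduct_smul, smul_eq_mul, ← hX]
      field_simp
      simp
    have hv : v = ((x ⬝ᵥ (V *ᵥ v)) / X) • x + (v - ((x ⬝ᵥ (V *ᵥ v)) / X) • x) := by abel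
    refine ⟨_, _, hv, hy, (equiv _ _ hy).2 ?_⟩
    rw [← hv]
    exact h

theorem mem_interior_iceCreamCone (hV : V.PosDef) {x : Fin m → ℝ} (hx : x ≠ 0) :
    x ∈ interior (iceCreamCone V x) := by
  have hp := dotProduct_mulVec_self_pos hV hx
  rw [mem_interior]
  refine ⟨{v | √(v ⬝ᵥ (V *ᵥ v)) * √(x ⬝ᵥ (V *ᵥ x)) < √2 * (x ⬝ᵥ (V *ᵥ v))}, ?_, ?_, ?_⟩
  · intro v hv
    exact (mem_iceCreamCone_iff hV hx v).2 (le_of_lt hv)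
  · apply isOpen_lt <;> fun_prop
  · rw [Set.mem_ofPred_eq, Real.mul_self_sqrt hp.le]
    have : (1 : ℝ) < √2 := by rw [Real.lt_sqrt] <;> norm_num
    nlinarith

theorem isProperCone_iceCreamCone (hV : V.PosDef) {x : Fin m → ℝ} (hx : x ≠ 0) :
    IsProperCone (iceCreamCone V x) where
  smul_mem a ha v hv := by
    rw [mem_iceCreamCone_iff hV hx] at *
    rw [sqrt_form_smul hV v ha, mulVec_smul, dotProduct_smul, smul_eq_mul]
    nlinarith
  add_mem v hv w hw := by
    rw [mem_iceCreamCone_iff hV hx] at *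
    have h := mul_le_mul_of_nonneg_right (sqrt_form_add_le hV v w)
      (Real.sqrt_nonneg (x ⬝ᵥ (V *ᵥ x)))
    have e : x ⬝ᵥ (V *ᵥ (v + w)) = x ⬝ᵥ (V *ᵥ v) + x ⬝ᵥ (V *ᵥ w) := by
      rw [mulVec_add, dotProduct_add]
    rw [e]
    linarith
  closed := by
    have : iceCreamCone V x =
        {v | √(v ⬝ᵥ (V *ᵥ v)) * √(x ⬝ᵥ (V *ᵥ x)) ≤ √2 * (x ⬝ᵥ (V *ᵥ v))} :=
      Set.ext (mem_iceCreamCone_iff hV hx)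
    rw [this]
    apply isClosed_le <;> fun_prop
  pointed := by
    ext v
    simp only [Set.mem_ofPred_eq, Set.mem_singleton_iff, mem_iceCreamCone_iff hV hx]
    constructor
    · rintro ⟨h1, h2⟩
      by_contra hv
      have a := Real.sqrt_pos.2 (dotProduct_mulVec_self_pos hV hv)
      have b := Real.sqrt_pos.2 (dotProduct_mulVec_self_pos hV hx)
      simp only [mulVec_neg, dotProduct_neg, neg_dotProduct, neg_neg] at h2
      have := mul_pos a b
      linarith
    · rintro rfl
      simp
  solid := ⟨x, mem_interior_iceCreamCone hV hx⟩

/-- A contraction up to the factor `r` that attains `r` at `x` satisfies `⟨x, A v⟩ = r ⟨x, v⟩`, so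
both sides of the cone inequality are controlled by the same factor. -/
theorem isInvariant_iceCreamCone (hV : V.PosDef) {x : Fin m → ℝ} (hx : x ≠ 0)
    {A : Matrix (Fin m) (Fin m) ℝ} {r : ℝ} (hr : 0 ≤ r) (hA : A *ᵥ x = r • x)
    (hc : ∀ v, (A *ᵥ v) ⬝ᵥ (V *ᵥ (A *ᵥ v)) ≤ r ^ 2 * (v ⬝ᵥ (V *ᵥ v))) :
    IsInvariant A (iceCreamCone V x) := by
  intro v hv
  rw [mem_iceCreamCone_iff hV hx] at *
  have hs : √((A *ᵥ v) ⬝ᵥ (V *ᵥ (A *ᵥ v))) ≤ r * √(v ⬝ᵥ (V *ᵥ v)) := by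
    refine (Real.sqrt_le_sqrt (hc v)).trans_eq ?_
    rw [Real.sqrt_mul (sq_nonneg r), Real.sqrt_sq hr]
  rcases hr.eq_or_lt with h0 | hr0
  · have : A *ᵥ v = 0 := by
      by_contra h
      have := dotProduct_mulVec_self_pos hV h
      have := hc v
      simp only [← h0] at this
      linarith
    simp [this]
  have hl : x ⬝ᵥ (V *ᵥ (A *ᵥ v)) = r * (x ⬝ᵥ (V *ᵥ v)) := by
    -- The norm bound at `x + t v`. The constant term vanishes because `x` attains the bound, so
    -- nonnegativity for all `t` kills the linear coefficient.
    have q : ∀ t : ℝ, 0 ≤ (r ^ 2 * (v ⬝ᵥ (V *ᵥ v)) - (A *ᵥ v) ⬝ᵥ (V *ᵥ (A *ᵥ v))) * (t * t) +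
        (2 * r * (r * (x ⬝ᵥ (V *ᵥ v)) - x ⬝ᵥ (V *ᵥ (A *ᵥ v)))) * t + 0 := by
      intro t
      have h := hc ((1 : ℝ) • x + t • v)
      have e : A *ᵥ ((1 : ℝ) • x + t • v) = r • x + t • (A *ᵥ v) := by
        simp [mulVec_add, mulVec_smul, hA]
      rw [e, form_add_smul hV, form_add_smul hV] at h
      linarith
    have d := discrim_le_zero q
    rw [discrim] at d
    have : (2 * r * (r * (x ⬝ᵥ (V *ᵥ v)) - x ⬝ᵥ (V *ᵥ (A *ᵥ v)))) = 0 := by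
      apply pow_eq_zero_iff (two_ne_zero) |>.1
      nlinarith [sq_nonneg (2 * r * (r * (x ⬝ᵥ (V *ᵥ v)) - x ⬝ᵥ (V *ᵥ (A *ᵥ v))))]
    have h2 : 2 * r ≠ 0 := by positivity
    have := (mul_eq_zero.1 this).resolve_left h2
    linarith
  rw [hl]
  have := mul_le_mul_of_nonneg_right hs (Real.sqrt_nonneg (x ⬝ᵥ (V *ᵥ x)))
  nlinarith

end Geometry

/-! ### Hermitian forms bounding a commuting family -/

section HermitianForms

open Polynomial
open scoped ComplexOrder

variable {m : ℕ}

/-- The real-valued quadratic form `v ↦ vᴴ H v`. -/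
def hermForm (H : Matrix (Fin m) (Fin m) ℂ) (v : Fin m → ℂ) : ℝ :=
  (star v ⬝ᵥ (H *ᵥ v)).re

theorem hermForm_zero (v : Fin m → ℂ) : hermForm (0 : Matrix (Fin m) (Fin m) ℂ) v = 0 := by
  simp [hermForm]

theorem hermForm_add (H G : Matrix (Fin m) (Fin m) ℂ) (v : Fin m → ℂ) :
    hermForm (H + G) v = hermForm H v + hermForm G v := by
  simp [hermForm, add_mulVec]

theorem hermForm_smul (c : ℝ) (H : Matrix (Fin m) (Fin m) ℂ) (v : Fin m → ℂ) :
    hermForm (c • H) v = c * hermForm H v := by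
  simp [hermForm, smul_mulVec]

theorem hermForm_sum {ι : Type*} (s : Finset ι) (H : ι → Matrix (Fin m) (Fin m) ℂ)
    (v : Fin m → ℂ) : hermForm (∑ i ∈ s, H i) v = ∑ i ∈ s, hermForm (H i) v := by
  classical
  induction s using Finset.induction_on with
  | empty => simp [hermForm_zero]
  | insert a s ha ih => rw [Finset.sum_insert ha, Finset.sum_insert ha, hermForm_add, ih]

theorem hermForm_conj (P H : Matrix (Fin m) (Fin m) ℂ) (v : Fin m → ℂ) :
    hermForm (Pᴴ * H * P) v = hermForm H (P *ᵥ v) := by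
  simp only [hermForm, star_mulVec, ← mulVec_mulVec, dotProduct_mulVec, vecMul_vecMul,
    Matrix.mul_assoc]

theorem hermForm_smul_vec (H : Matrix (Fin m) (Fin m) ℂ) (a : ℂ) (v : Fin m → ℂ) :
    hermForm H (a • v) = ‖a‖ ^ 2 * hermForm H v := by
  have : a * star a = ((‖a‖ ^ 2 : ℝ) : ℂ) := by
    simpa using Complex.mul_conj' a
  simp only [hermForm, star_smul, mulVec_smul, smul_dotProduct, dotProduct_smul, smul_eq_mul]
  rw [← mul_assoc, this, Complex.re_ofReal_mul]

theorem hermForm_nonneg {H : Matrix (Fin m) (Fin m) ℂ} (hH : H.PosSemidef) (v : Fin m → ℂ) :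
    0 ≤ hermForm H v :=
  (Complex.le_def.1 (hH.dotProduct_mulVec_nonneg v)).1

theorem hermForm_pos {H : Matrix (Fin m) (Fin m) ℂ} (hH : H.PosDef) {v : Fin m → ℂ}
    (hv : v ≠ 0) : 0 < hermForm H v :=
  (Complex.lt_def.1 (hH.dotProduct_mulVec_pos hv)).1

theorem hermForm_young {H : Matrix (Fin m) (Fin m) ℂ} (hH : H.PosSemidef) {δ : ℝ} (hδ : 0 < δ)
    (v w : Fin m → ℂ) :
    hermForm H (v + w) ≤ (1 + δ) * hermForm H v + (1 + 1 / δ) * hermForm H w := by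
  have key : δ * hermForm H (v + w) + hermForm H ((δ : ℂ) • v - w) =
      (δ + δ ^ 2) * hermForm H v + (1 + δ) * hermForm H w := by
    simp only [hermForm, star_add, star_sub, star_smul, mulVec_add, mulVec_sub, mulVec_smul,
      dotProduct_add, dotProduct_sub, add_dotProduct, sub_dotProduct, smul_dotProduct,
      dotProduct_smul, smul_eq_mul, Complex.star_def, Complex.conj_ofReal, Complex.add_re,
      Complex.sub_re, Complex.re_ofReal_mul]
    ring
  have h0 := hermForm_nonneg hH ((δ : ℂ) • v - w)
  have : δ * hermForm H (v + w) ≤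
      δ * ((1 + δ) * hermForm H v + (1 + 1 / δ) * hermForm H w) := by
    have e : δ * ((1 + δ) * hermForm H v + (1 + 1 / δ) * hermForm H w) =
      (δ + δ ^ 2) * hermForm H v + (1 + δ) * hermForm H w := by
      field_simp
      ring
    linarith
  exact le_of_mul_le_mul_left this hδ

theorem exists_hermForm_smul_add_le {H : Matrix (Fin m) (Fin m) ℂ} (hH : H.PosSemidef)
    {a : ℂ} {r : ℝ} (ha : ‖a‖ < r) :
    ∃ θ K : ℝ, θ < r ^ 2 ∧ 0 ≤ K ∧
      ∀ v w, hermForm H (a • v + w) ≤ θ * hermForm H v + K * hermForm H w := by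
  have hr : 0 < r := (norm_nonneg a).trans_lt ha
  have hsq : ‖a‖ ^ 2 < r ^ 2 := by gcongr
  -- Spends at most half of the gap `r² - ‖a‖²`, so `(1 + δ)‖a‖²` stays below `r²`.
  set δ := (r ^ 2 - ‖a‖ ^ 2) / (2 * r ^ 2) with hδ
  have hδ0 : 0 < δ := by apply div_pos <;> [linarith; positivity]
  have h2 : δ * r ^ 2 = (r ^ 2 - ‖a‖ ^ 2) / 2 := by rw [hδ]; field_simp
  refine ⟨(1 + δ) * ‖a‖ ^ 2, 1 + 1 / δ, by nlinarith, by positivity, fun v w => ?_⟩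
  have := hermForm_young hH hδ0 (a • v) w
  rwa [hermForm_smul_vec, ← mul_assoc] at this

/-- `A` has norm at most `r` for the seminorm given by `H`. -/
def IsBoundedBy (H A : Matrix (Fin m) (Fin m) ℂ) (r : ℝ) : Prop :=
  ∀ v, hermForm H (A *ᵥ v) ≤ r ^ 2 * hermForm H v

theorem IsBoundedBy.add {H G A : Matrix (Fin m) (Fin m) ℂ} {r : ℝ} (h : IsBoundedBy H A r)
    (h' : IsBoundedBy G A r) : IsBoundedBy (H + G) A r := fun v => by
  rw [hermForm_add, hermForm_add]
  linarith [h v, h' v]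

theorem IsBoundedBy.smul {H A : Matrix (Fin m) (Fin m) ℂ} {r c : ℝ} (h : IsBoundedBy H A r)
    (hc : 0 ≤ c) : IsBoundedBy (c • H) A r := fun v => by
  rw [hermForm_smul, hermForm_smul]
  nlinarith [h v]

theorem IsBoundedBy.sum {ι : Type*} {s : Finset ι} {H : ι → Matrix (Fin m) (Fin m) ℂ}
    {A : Matrix (Fin m) (Fin m) ℂ} {r : ℝ} (h : ∀ i ∈ s, IsBoundedBy (H i) A r) :
    IsBoundedBy (∑ i ∈ s, H i) A r := fun v => by
  rw [hermForm_sum, hermForm_sum, Finset.mul_sum]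
  exact Finset.sum_le_sum fun i hi => h i hi v

/-- This is what lets the form be rebuilt for a new matrix without losing the bounds already
obtained. -/
theorem IsBoundedBy.conj {H A P : Matrix (Fin m) (Fin m) ℂ} {r : ℝ} (h : IsBoundedBy H A r)
    (hP : Commute P A) : IsBoundedBy (Pᴴ * H * P) A r := fun v => by
  rw [hermForm_conj, hermForm_conj, mulVec_mulVec, hP.eq, ← mulVec_mulVec]
  exact h _

theorem commute_aeval {A B : Matrix (Fin m) (Fin m) ℂ} (h : Commute A B) (p : ℂ[X]) :
    Commute (aeval B p) A := by
  induction p using Polynomial.induction_on' with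
  | add p q hp hq => simpa using hp.add_left hq
  | monomial n c =>
    rw [aeval_monomial]
    exact Commute.mul_left (Algebra.commutes c A) (h.symm.pow_left n)

/-- A form for which `B` is bounded by `r` up to an error supported on the complement of the
kernel of `∏ (B - a)`, where all `a` satisfy `‖a‖ < r`. -/
theorem exists_chain_form {H B : Matrix (Fin m) (Fin m) ℂ} (hH : H.PosDef) {r : ℝ}
    (𝒞 : Set (Matrix (Fin m) (Fin m) ℂ)) (R : Matrix (Fin m) (Fin m) ℂ → ℝ)
    (hC : ∀ A ∈ 𝒞, IsBoundedBy H A (R A)) (hcomm : ∀ A ∈ 𝒞, Commute A B)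
    (s : Multiset ℂ) (hs : ∀ a ∈ s, ‖a‖ < r) :
    ∃ (G : Matrix (Fin m) (Fin m) ℂ) (K : ℝ), G.PosSemidef ∧ 0 ≤ K ∧
      (∀ A ∈ 𝒞, IsBoundedBy G A (R A)) ∧
      (∀ v, hermForm G (B *ᵥ v) ≤ r ^ 2 * hermForm G v +
        K * hermForm H (aeval B (s.map fun a => X - C a).prod *ᵥ v)) ∧
      ∀ v, hermForm G v = 0 → aeval B (s.map fun a => X - C a).prod *ᵥ v = 0 → v = 0 := by
  induction s using Multiset.induction_on with
  | empty =>
    refine ⟨0, 0, PosSemidef.zero, le_rfl, fun A _ v => by simp [hermForm_zero],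
      fun v => by simp [hermForm_zero], fun v _ h => by simpa using h⟩
  | cons a s ih =>
    obtain ⟨G, K, hG, hK, hGC, hGB, hG0⟩ := ih fun b hb => hs b (Multiset.mem_cons_of_mem hb)
    obtain ⟨θ, L, hθ, hL, hyoung⟩ := exists_hermForm_smul_add_le hH.posSemidef
      (hs a (Multiset.mem_cons_self a s))
    set P := aeval B (s.map fun a => X - C a).prod with hP
    have hPs : aeval B ((a ::ₘ s).map fun a => X - C a).prod = (B - algebraMap ℂ _ a) * P := by
      simp [hP]
    have hgap : 0 < r ^ 2 - θ := by linarith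
    -- A weight so large that the gap `M(r² - θ)` absorbs the previous error `K`; the `+ 1` keeps
    -- `M` positive when `K = 0`.
    set M := (K + 1) / (r ^ 2 - θ) with hM
    have hM0 : 0 < M := by positivity
    have hMK : K + M * θ ≤ M * r ^ 2 := by
      have : M * (r ^ 2 - θ) = K + 1 := by rw [hM]; field_simp
      linarith
    refine ⟨G + M • (Pᴴ * H * P), M * L,
      hG.add ((hH.posSemidef.conjTranspose_mul_mul_same P).smul hM0.le), by positivity,
      fun A hA => (hGC A hA).add (((hC A hA).conj (commute_aeval (hcomm A hA) _)).smul hM0.le),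
      fun v => ?_, fun v hv _ => ?_⟩
    · have hcommP : P *ᵥ (B *ᵥ v) = a • (P *ᵥ v) + aeval B
          ((a ::ₘ s).map fun a => X - C a).prod *ᵥ v := by
        rw [hPs, mulVec_mulVec, (commute_aeval (Commute.refl B) _).eq, sub_mul, sub_mulVec,
          ← Algebra.smul_def, smul_mulVec]
        abel
      simp only [hermForm_add, hermForm_smul, hermForm_conj]
      rw [hcommP]
      have h1 := hGB v
      have h2 := mul_le_mul_of_nonneg_left (hyoung (P *ᵥ v) (aeval B
          ((a ::ₘ s).map fun a => X - C a).prod *ᵥ v)) hM0.le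
      have h3 := mul_le_mul_of_nonneg_right hMK (hermForm_nonneg hH.posSemidef (P *ᵥ v))
      linarith
    · simp only [hermForm_add, hermForm_smul, hermForm_conj] at hv
      have h1 := hermForm_nonneg hG v
      have h2 := mul_nonneg hM0.le (hermForm_nonneg hH.posSemidef (P *ᵥ v))
      refine hG0 v (by linarith) ?_
      by_contra hne
      have := mul_pos hM0 (hermForm_pos hH hne)
      linarith

/-- The polynomials annihilating `v` form an ideal of `ℂ[X]`; without a common zero its generator is
a unit, so `1` annihilates `v`. -/
theorem eq_zero_of_aeval_mulVec_eq_zero {B : Matrix (Fin m) (Fin m) ℂ} {v : Fin m → ℂ}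
    (h : ∀ z : ℂ, ∃ p : ℂ[X], aeval B p *ᵥ v = 0 ∧ p.eval z ≠ 0) : v = 0 := by
  let I : Ideal ℂ[X] :=
    { carrier := {p | aeval B p *ᵥ v = 0}
      add_mem' := fun {p q} hp hq => by
        simp only [Set.mem_ofPred_eq] at *
        rw [map_add, add_mulVec, hp, hq, add_zero]
      zero_mem' := by simp
      smul_mem' := fun c p hp => by
        simp only [Set.mem_ofPred_eq] at *
        rw [smul_eq_mul, map_mul, ← mulVec_mulVec, hp, mulVec_zero] }
  have hI : ∀ p, p ∈ I ↔ aeval B p *ᵥ v = 0 := fun p => Iff.rfl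
  set d := Submodule.IsPrincipal.generator I with hd
  have hdvd : ∀ p, aeval B p *ᵥ v = 0 → d ∣ p := fun p hp =>
    (Submodule.IsPrincipal.mem_iff_generator_dvd I).1 hp
  have hdeg : d.degree = 0 := by
    by_contra hne
    obtain ⟨z, hz⟩ := IsAlgClosed.exists_root d hne
    obtain ⟨p, hp, hpz⟩ := h z
    exact hpz (hz.dvd (hdvd p hp))
  have hu : IsUnit d := Polynomial.isUnit_iff_degree_eq_zero.2 hdeg
  have h1 : (1 : ℂ[X]) ∈ I := (Submodule.IsPrincipal.mem_iff_generator_dvd I).2 hu.dvd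
  simpa using (hI 1).1 h1

/-- Split the minimal polynomial as `ps * pt`, with roots inside and on the circle `‖a‖ = r`. Each
peripheral root contributes the pullback of `H` along its cofactor `E a`, whose range consists of
eigenvectors. The chain form is pulled back along `Q = pt(B)`; its error term vanishes there because
`ps(B) Q = 0`. -/
theorem exists_posDef_isBoundedBy_insert {H B : Matrix (Fin m) (Fin m) ℂ} (hH : H.PosDef) {r : ℝ}
    (𝒞 : Set (Matrix (Fin m) (Fin m) ℂ)) (R : Matrix (Fin m) (Fin m) ℂ → ℝ)
    (hC : ∀ A ∈ 𝒞, IsBoundedBy H A (R A)) (hcomm : ∀ A ∈ 𝒞, Commute A B)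
    (hle : ∀ a ∈ (minpoly ℂ B).roots, ‖a‖ ≤ r)
    (hsimple : ∀ a ∈ (minpoly ℂ B).roots, ‖a‖ = r → (minpoly ℂ B).rootMultiplicity a ≤ 1) :
    ∃ G : Matrix (Fin m) (Fin m) ℂ, G.PosDef ∧ (∀ A ∈ 𝒞, IsBoundedBy G A (R A)) ∧
      IsBoundedBy G B r := by
  classical
  set p := minpoly ℂ B with hp
  have hpB : aeval B p = 0 := minpoly.aeval ℂ B
  have hmonic : p.Monic := minpoly.monic (Algebra.IsIntegral.isIntegral B)
  have hsplit : (p.roots.map fun a => X - C a).prod = p :=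
    ((IsAlgClosed.splits p).eq_prod_roots_of_monic hmonic).symm
  set s := p.roots.filter (fun a => ‖a‖ < r) with hs
  set t := p.roots.filter (fun a => ¬ ‖a‖ < r) with ht
  set pt := (t.map fun a => X - C a).prod with hpt
  set ps := (s.map fun a => X - C a).prod with hps
  have hst : ps * pt = p := by
    rw [hps, hpt, ← Multiset.prod_add, ← Multiset.map_add, Multiset.filter_add_not, hsplit]
  obtain ⟨G, K, hG, hK, hGC, hGB, hG0⟩ := exists_chain_form (B := B) (r := r) hH 𝒞 R hC hcomm s
    (fun a ha => (Multiset.mem_filter.1 ha).2)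
  have hdiv : ∀ a ∈ t.toFinset, ((X - C a) * (p /ₘ (X - C a)) = p ∧ ‖a‖ = r ∧
      (p /ₘ (X - C a)).eval a ≠ 0) := by
    intro a ha
    obtain ⟨har, hn⟩ := Multiset.mem_filter.1 (Multiset.mem_toFinset.1 ha)
    have hroot : p.IsRoot a := isRoot_of_mem_roots har
    have hnorm : ‖a‖ = r := le_antisymm (hle a har) (not_lt.1 hn)
    have hmul := mul_divByMonic_eq_iff_isRoot.2 hroot
    -- If the cofactor also vanished at `a`, then `a` would be a double root, against simplicity on
    -- the circle.
    refine ⟨hmul, hnorm, fun h0 => ?_⟩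
    have h2 : (X - C a) ^ 2 ∣ p := by
      obtain ⟨c, hc⟩ := dvd_iff_isRoot.2 h0
      refine ⟨c, ?_⟩
      rw [← hmul, hc]; ring
    have := (le_rootMultiplicity_iff hmonic.ne_zero).2 h2
    have := hsimple a har hnorm
    omega
  let E : ℂ → Matrix (Fin m) (Fin m) ℂ := fun a => aeval B (p /ₘ (X - C a))
  set Q := aeval B pt with hQ
  have hPSD : ((∑ a ∈ t.toFinset, (E a)ᴴ * H * E a) + Qᴴ * G * Q).PosSemidef :=
    (Matrix.posSemidef_sum _ fun a _ => hH.posSemidef.conjTranspose_mul_mul_same _).add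
      (hG.conjTranspose_mul_mul_same _)
  have hval : ∀ v, hermForm ((∑ a ∈ t.toFinset, (E a)ᴴ * H * E a) + Qᴴ * G * Q) v =
      ∑ a ∈ t.toFinset, hermForm H (E a *ᵥ v) + hermForm G (Q *ᵥ v) := by
    intro v
    simp only [hermForm_add, hermForm_sum, hermForm_conj]
  have hsQ : ∀ v, aeval B ps *ᵥ (Q *ᵥ v) = 0 := by
    intro v
    rw [mulVec_mulVec, hQ, ← map_mul, hst, hpB, zero_mulVec]
  refine ⟨_, PosDef.of_dotProduct_mulVec_pos hPSD.isHermitian fun v hv => ?_, fun A hA => ?_, ?_⟩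
  · refine Complex.lt_def.2 ⟨lt_of_le_of_ne (hermForm_nonneg hPSD v) fun h0 => hv ?_,
      (Complex.le_def.1 (hPSD.dotProduct_mulVec_nonneg v)).2⟩
    change 0 = hermForm _ v at h0
    rw [hval] at h0
    have hn1 : ∀ a ∈ t.toFinset, 0 ≤ hermForm H (E a *ᵥ v) :=
      fun a _ => hermForm_nonneg hH.posSemidef _
    have hn2 := hermForm_nonneg hG (Q *ᵥ v)
    have hn3 := Finset.sum_nonneg hn1
    have hQ0 : Q *ᵥ v = 0 := hG0 _ (by linarith) (hsQ v)
    have hE0 : ∀ a ∈ t.toFinset, E a *ᵥ v = 0 := by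
      intro a ha
      have := (Finset.sum_eq_zero_iff_of_nonneg hn1).1 (by linarith) a ha
      by_contra hne
      exact (hermForm_pos hH hne).ne' this
    apply eq_zero_of_aeval_mulVec_eq_zero (B := B)
    intro z
    -- A peripheral `z` is missed by its own cofactor, any other `z` by `pt`.
    by_cases hz : z ∈ t.toFinset
    · exact ⟨_, hE0 z hz, (hdiv z hz).2.2⟩
    · refine ⟨pt, hQ0, fun h => hz ?_⟩
      rw [hpt, eval_multiset_prod, Multiset.prod_eq_zero_iff] at h
      simp only [Multiset.map_map, Function.comp, Multiset.mem_map] at h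
      obtain ⟨a, ha, h⟩ := h
      simp only [eval_sub, eval_X, eval_C, sub_eq_zero] at h
      rw [h]
      exact Multiset.mem_toFinset.2 ha
  · exact (IsBoundedBy.sum fun a _ => (hC A hA).conj (commute_aeval (hcomm A hA) _)).add
      ((hGC A hA).conj (commute_aeval (hcomm A hA) _))
  · apply IsBoundedBy.add
    · refine IsBoundedBy.sum fun a ha v => le_of_eq ?_
      obtain ⟨hmul, hnorm, -⟩ := hdiv a ha
      have : E a *ᵥ (B *ᵥ v) = a • (E a *ᵥ v) := by
        have h0 : (B - algebraMap ℂ _ a) * E a = 0 := by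
          have := congrArg (aeval B) hmul
          rw [hpB] at this
          simpa [E] using this
        rw [sub_mul, sub_eq_zero, ← Algebra.smul_def] at h0
        rw [mulVec_mulVec, (commute_aeval (Commute.refl B) _).eq, h0, smul_mulVec]
      rw [hermForm_conj, hermForm_conj, this, hermForm_smul_vec, hnorm]
    · intro v
      rw [hermForm_conj, hermForm_conj, mulVec_mulVec, (commute_aeval (Commute.refl B) _).eq,
        ← mulVec_mulVec]
      have := hGB (Q *ᵥ v)
      rw [hsQ v] at this
      simpa [hermForm] using this

theorem exists_posDef_isBoundedBy (𝒞 : Set (Matrix (Fin m) (Fin m) ℂ))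
    (R : Matrix (Fin m) (Fin m) ℂ → ℝ) (hfin : 𝒞.Finite)
    (hcomm : ∀ A ∈ 𝒞, ∀ B ∈ 𝒞, Commute A B)
    (hle : ∀ A ∈ 𝒞, ∀ a ∈ (minpoly ℂ A).roots, ‖a‖ ≤ R A)
    (hsimple : ∀ A ∈ 𝒞, ∀ a ∈ (minpoly ℂ A).roots, ‖a‖ = R A →
      (minpoly ℂ A).rootMultiplicity a ≤ 1) :
    ∃ G : Matrix (Fin m) (Fin m) ℂ, G.PosDef ∧ ∀ A ∈ 𝒞, IsBoundedBy G A (R A) := by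
  induction 𝒞, hfin using Set.Finite.induction_on with
  | empty => exact ⟨1, PosDef.one, by simp⟩
  | @insert B 𝒞 _ _ ih =>
    obtain ⟨H, hH, hC⟩ := ih
      (fun A hA C hC => hcomm A (Set.mem_insert_of_mem _ hA) C (Set.mem_insert_of_mem _ hC))
      (fun A hA => hle A (Set.mem_insert_of_mem _ hA))
      (fun A hA => hsimple A (Set.mem_insert_of_mem _ hA))
    obtain ⟨G, hG, hGC, hGB⟩ := exists_posDef_isBoundedBy_insert hH 𝒞 R hC
      (fun A hA => hcomm A (Set.mem_insert_of_mem _ hA) B (Set.mem_insert _ _))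
      (hle B (Set.mem_insert _ _)) (hsimple B (Set.mem_insert _ _))
    refine ⟨G, hG, fun A hA => ?_⟩
    rcases Set.mem_insert_iff.1 hA with rfl | hA
    · exact hGB
    · exact hGC A hA

end HermitianForms

/-! ### Spectral radius, the normal case, descent to real forms -/

section Main

open Polynomial
open scoped ComplexOrder

variable {m : ℕ}

theorem toComplex_mulVec_ofReal (A : Matrix (Fin m) (Fin m) ℝ) (v : Fin m → ℝ) :
    toComplex A *ᵥ (fun i => (v i : ℂ)) = fun i => ((A *ᵥ v) i : ℂ) := by
  ext i
  simp [toComplex, mulVec, dotProduct]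

theorem toComplex_mul (A B : Matrix (Fin m) (Fin m) ℝ) :
    toComplex (A * B) = toComplex A * toComplex B :=
  Matrix.map_mul

theorem toComplex_one : toComplex (1 : Matrix (Fin m) (Fin m) ℝ) = 1 := by
  simp [toComplex]

theorem toComplex_star (A : Matrix (Fin m) (Fin m) ℝ) :
    toComplex (star A) = star (toComplex A) := by
  ext i j
  simp [toComplex, star_eq_conjTranspose]

/-- Needed because `ENNReal.toReal` sends `⊤` to `0`. -/
theorem spectralRadius_ne_top (A : Matrix (Fin m) (Fin m) ℂ) : spectralRadius ℂ A ≠ ⊤ := by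
  obtain ⟨M, hM⟩ := ((Matrix.finite_spectrum A).image fun k => ‖k‖₊).bddAbove
  refine ne_top_of_le_ne_top (ENNReal.coe_ne_top (r := M)) (iSup₂_le fun k hk => ?_)
  exact ENNReal.coe_le_coe.2 (hM ⟨k, hk, rfl⟩)

theorem specRadius_nonneg (A : Matrix (Fin m) (Fin m) ℝ) : 0 ≤ specRadius A :=
  ENNReal.toReal_nonneg

theorem norm_le_specRadius {A : Matrix (Fin m) (Fin m) ℝ} {a : ℂ}
    (ha : a ∈ spectrum ℂ (toComplex A)) : ‖a‖ ≤ specRadius A := by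
  have h : (‖a‖₊ : ENNReal) ≤ spectralRadius ℂ (toComplex A) :=
    le_iSup₂ (f := fun k (_ : k ∈ spectrum ℂ (toComplex A)) => (‖k‖₊ : ENNReal)) a ha
  simpa [specRadius] using ENNReal.toReal_mono (spectralRadius_ne_top _) h

theorem mem_spectrum_of_mem_roots_minpoly {A : Matrix (Fin m) (Fin m) ℂ} {a : ℂ}
    (ha : a ∈ (minpoly ℂ A).roots) : a ∈ spectrum ℂ A := by
  rw [← Matrix.spectrum_toLin', ← Module.End.hasEigenvalue_iff_mem_spectrum]
  apply Module.End.hasEigenvalue_of_isRoot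
  rw [Matrix.minpoly_toLin']
  exact isRoot_of_mem_roots ha

section Normal

open scoped Matrix.Norms.L2Operator

/-- With the `L2` operator norm, matrices form a C⋆-algebra, where a normal element has norm equal
to its spectral radius. -/
theorem norm_mulVec_le_of_isStarNormal {N : Matrix (Fin m) (Fin m) ℂ} (hN : IsStarNormal N)
    (v : Fin m → ℂ) :
    ‖WithLp.toLp 2 (N *ᵥ v)‖ ≤ (spectralRadius ℂ N).toReal * ‖WithLp.toLp 2 v‖ := by
  rw [IsStarNormal.spectralRadius_eq_nnnorm N]
  simpa using Matrix.l2_opNorm_mulVec N (WithLp.toLp 2 v)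

end Normal

theorem norm_sq_toLp_ofReal (v : Fin m → ℝ) :
    ‖WithLp.toLp 2 (fun i => (v i : ℂ))‖ ^ 2 = v ⬝ᵥ v := by
  rw [EuclideanSpace.norm_sq_eq]
  simp [dotProduct, sq]

theorem dotProduct_mulVec_le_of_isStarNormal {N : Matrix (Fin m) (Fin m) ℝ}
    (hN : IsStarNormal N) (v : Fin m → ℝ) :
    (N *ᵥ v) ⬝ᵥ (N *ᵥ v) ≤ specRadius N ^ 2 * (v ⬝ᵥ v) := by
  have hC : IsStarNormal (toComplex N) := ⟨by
    have h := congrArg toComplex hN.star_comm_self.eq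
    rwa [toComplex_mul, toComplex_mul, toComplex_star] at h⟩
  have h := norm_mulVec_le_of_isStarNormal hC (fun i => (v i : ℂ))
  rw [toComplex_mulVec_ofReal] at h
  rw [← norm_sq_toLp_ofReal, ← norm_sq_toLp_ofReal, ← mul_pow]
  exact pow_le_pow_left₀ (norm_nonneg _) h 2

theorem specRadius_conj {S : Matrix (Fin m) (Fin m) ℝ} (hS : IsUnit S)
    (A : Matrix (Fin m) (Fin m) ℝ) : specRadius (S⁻¹ * A * S) = specRadius A := by
  have hd : IsUnit S.det := (Matrix.isUnit_iff_isUnit_det S).1 hS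
  let u : (Matrix (Fin m) (Fin m) ℂ)ˣ :=
    ⟨toComplex S, toComplex S⁻¹,
      by rw [← toComplex_mul, Matrix.mul_nonsing_inv _ hd, toComplex_one],
      by rw [← toComplex_mul, Matrix.nonsing_inv_mul _ hd, toComplex_one]⟩
  have h := spectrum.units_conjugate' (R := ℂ) (a := toComplex A) (u := u)
  have e : toComplex (S⁻¹ * A * S) = (↑u⁻¹ : Matrix (Fin m) (Fin m) ℂ) * toComplex A * u := by
    rw [toComplex_mul, toComplex_mul]
    rfl
  rw [specRadius, specRadius, spectralRadius, e, h, ← spectralRadius]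

theorem mulVec_inv_cancel {S : Matrix (Fin m) (Fin m) ℝ} (hS : IsUnit S) (v : Fin m → ℝ) :
    S *ᵥ (S⁻¹ *ᵥ v) = v ∧ S⁻¹ *ᵥ (S *ᵥ v) = v := by
  have hd : IsUnit S.det := (Matrix.isUnit_iff_isUnit_det S).1 hS
  simp [mulVec_mulVec, Matrix.mul_nonsing_inv _ hd, Matrix.nonsing_inv_mul _ hd]

theorem form_inv_transpose (S : Matrix (Fin m) (Fin m) ℝ) (v w : Fin m → ℝ) :
    v ⬝ᵥ ((S⁻¹ᵀ * S⁻¹) *ᵥ w) = (S⁻¹ *ᵥ v) ⬝ᵥ (S⁻¹ *ᵥ w) := by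
  rw [← mulVec_mulVec, dotProduct_mulVec, vecMul_transpose]

theorem posDef_inv_transpose_mul_inv {S : Matrix (Fin m) (Fin m) ℝ} (hS : IsUnit S) :
    (S⁻¹ᵀ * S⁻¹).PosDef := by
  have := Matrix.PosDef.conjTranspose_mul_self S⁻¹
    (fun v w h => by
      have h : S⁻¹ *ᵥ v = S⁻¹ *ᵥ w := h
      rw [← (mulVec_inv_cancel hS v).1, h, (mulVec_inv_cancel hS w).1])
  simpa using this

/-- `S` is an isometry from the Euclidean inner product to the one given by `S⁻ᵀS⁻¹`. -/
theorem image_iceCreamCone_one {S : Matrix (Fin m) (Fin m) ℝ} (hS : IsUnit S)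
    (x : Fin m → ℝ) :
    (fun v => S *ᵥ v) '' iceCreamCone 1 (S⁻¹ *ᵥ x) = iceCreamCone (S⁻¹ᵀ * S⁻¹) x := by
  ext v
  constructor
  · rintro ⟨_, ⟨c, y, rfl, hy, hle⟩, rfl⟩
    refine ⟨c, S *ᵥ y, ?_, ?_, ?_⟩
    · simp only [mulVec_add, mulVec_smul, (mulVec_inv_cancel hS x).1]
    · rw [form_inv_transpose, (mulVec_inv_cancel hS y).2]
      simpa using hy
    · rw [form_inv_transpose, form_inv_transpose, (mulVec_inv_cancel hS y).2]
      simpa using hle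
  · rintro ⟨c, y, rfl, hy, hle⟩
    refine ⟨S⁻¹ *ᵥ (c • x + y), ⟨c, S⁻¹ *ᵥ y, ?_, ?_, ?_⟩, (mulVec_inv_cancel hS _).1⟩
    · simp only [mulVec_add, mulVec_smul]
    · simpa [form_inv_transpose] using hy
    · simpa [form_inv_transpose] using hle

theorem isCommonConeAround_iceCreamCone {𝒜 : Set (Matrix (Fin m) (Fin m) ℝ)} {x : Fin m → ℝ}
    (hx0 : x ≠ 0) (hx : ∀ A ∈ 𝒜, IsDominantEigenvector A x) {V : Matrix (Fin m) (Fin m) ℝ}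
    (hV : V.PosDef) (hc : ∀ A ∈ 𝒜, ∀ v,
      (A *ᵥ v) ⬝ᵥ (V *ᵥ (A *ᵥ v)) ≤ specRadius A ^ 2 * (v ⬝ᵥ (V *ᵥ v))) :
    IsCommonConeAround 𝒜 x (iceCreamCone V x) where
  proper := isProperCone_iceCreamCone hV hx0
  invariant A hA :=
    isInvariant_iceCreamCone hV hx0 (specRadius_nonneg A) (hx A hA).2 (hc A hA)
  mem_interior := mem_interior_iceCreamCone hV hx0

theorem isCommonConeAround_of_normalizedBy {𝒜 : Set (Matrix (Fin m) (Fin m) ℝ)}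
    {x : Fin m → ℝ} (hx0 : x ≠ 0) (hx : ∀ A ∈ 𝒜, IsDominantEigenvector A x)
    {S : Matrix (Fin m) (Fin m) ℝ} (hS : NormalizedBy 𝒜 S) :
    IsCommonConeAround 𝒜 x (iceCreamCone (S⁻¹ᵀ * S⁻¹) x) := by
  refine isCommonConeAround_iceCreamCone hx0 hx (posDef_inv_transpose_mul_inv hS.1)
    fun A hA v => ?_
  have h := dotProduct_mulVec_le_of_isStarNormal (hS.2 A hA) (S⁻¹ *ᵥ v)
  rw [← mulVec_mulVec, (mulVec_inv_cancel hS.1 v).1, ← mulVec_mulVec,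
    specRadius_conj hS.1] at h
  rwa [form_inv_transpose, form_inv_transpose]

/-- Lets complex bounds descend to `ℝ`: on real vectors the imaginary part of `G` does not
contribute. -/
theorem hermForm_ofReal (G : Matrix (Fin m) (Fin m) ℂ) (v : Fin m → ℝ) :
    hermForm G (fun i => (v i : ℂ)) = v ⬝ᵥ (G.map Complex.re *ᵥ v) := by
  simp [hermForm, dotProduct, mulVec]

theorem posDef_map_re {G : Matrix (Fin m) (Fin m) ℂ} (hG : G.PosDef) :
    (G.map Complex.re).PosDef := by
  refine PosDef.of_dotProduct_mulVec_pos ?_ fun v hv => ?_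
  · ext i j
    have := congrArg Complex.re (hG.isHermitian.apply i j)
    simpa using this
  · have hv' : (fun i => (v i : ℂ)) ≠ 0 := fun h => hv <| by
      ext i
      simpa using congrFun h i
    have := hermForm_pos hG hv'
    rw [hermForm_ofReal] at this
    simpa using this

theorem exists_posDef_of_commuting {𝒜 : Set (Matrix (Fin m) (Fin m) ℝ)}
    (hV : ∀ A ∈ 𝒜, IsVandergraft A) (h : IsFiniteCommutingSemisimple 𝒜) :
    ∃ V : Matrix (Fin m) (Fin m) ℝ, V.PosDef ∧ ∀ A ∈ 𝒜, ∀ v,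
      (A *ᵥ v) ⬝ᵥ (V *ᵥ (A *ᵥ v)) ≤ specRadius A ^ 2 * (v ⬝ᵥ (V *ᵥ v)) := by
  obtain ⟨hfin, hcomm, hdeg⟩ := h
  obtain ⟨G, hG, hGb⟩ := exists_posDef_isBoundedBy (toComplex '' 𝒜)
    (fun A => (spectralRadius ℂ A).toReal) (hfin.image _)
    (by
      rintro _ ⟨A, hA, rfl⟩ _ ⟨B, hB, rfl⟩
      rw [Commute, SemiconjBy, ← toComplex_mul, hcomm A hA B hB, toComplex_mul])
    (by
      rintro _ ⟨A, hA, rfl⟩ a ha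
      exact norm_le_specRadius (mem_spectrum_of_mem_roots_minpoly ha))
    (by
      rintro _ ⟨A, hA, rfl⟩ a ha hn
      -- The Vandergraft condition passes semisimplicity from `ρ(A)` to the whole spectral circle.
      exact ((hV A hA).degree_le a (mem_spectrum_of_mem_roots_minpoly ha) hn).trans
        (hdeg A hA).le)
  refine ⟨G.map Complex.re, posDef_map_re hG, fun A hA v => ?_⟩
  have := hGb _ ⟨A, hA, rfl⟩ (fun i => (v i : ℂ))
  rwa [toComplex_mulVec_ofReal, hermForm_ofReal, hermForm_ofReal] at this

end Main
end CommonCone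
end

theorem mainTheorem2 (m : ℕ) (𝒜 : Set (Matrix (Fin m) (Fin m) ℝ)) (x : Fin m → ℝ)
    (hx0 : x ≠ 0)
    (hV : ∀ A ∈ 𝒜, CommonCone.IsVandergraft A)
    (hx : ∀ A ∈ 𝒜, CommonCone.IsDominantEigenvector A x) :
    ((∃ S : Matrix (Fin m) (Fin m) ℝ, CommonCone.NormalizedBy 𝒜 S) ∨
        CommonCone.IsFiniteCommutingSemisimple 𝒜 →
      ∃ K : Set (Fin m → ℝ), CommonCone.IsCommonConeAround 𝒜 x K ∧
        ∃ V : Matrix (Fin m) (Fin m) ℝ, V.PosDef ∧ K = CommonCone.iceCreamCone V x) ∧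
    (∀ S : Matrix (Fin m) (Fin m) ℝ, CommonCone.NormalizedBy 𝒜 S →
      CommonCone.IsCommonConeAround 𝒜 x
        ((fun v => S *ᵥ v) '' CommonCone.iceCreamCone 1 (S⁻¹ *ᵥ x))) := by
  refine ⟨?_, fun S hS => ?_⟩
  · rintro (⟨S, hS⟩ | h)
    · exact ⟨_, CommonCone.isCommonConeAround_of_normalizedBy hx0 hx hS, _,
        CommonCone.posDef_inv_transpose_mul_inv hS.1, rfl⟩
    · obtain ⟨V, hVp, hc⟩ := CommonCone.exists_posDef_of_commuting hV h
      exact ⟨_, CommonCone.isCommonConeAround_iceCreamCone hx0 hx hVp hc, V, hVp, rfl⟩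
  · rw [CommonCone.image_iceCreamCone_one hS.1]
    exact CommonCone.isCommonConeAround_of_normalizedBy hx0 hx hS
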